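/- Let $P$ be a finite poset. The rank $r(x)$ of $x\in P$ is defined recursively by $r(x)=0$ if $x$ is minimal and $r(x)=\max\{r(y):y<x\}+1$ otherwise; the layer $P_k$ is the set of elements of rank $k$. The poset $P$ is called LYM if every antichain $A\subseteq P$ satisfies $\sum_{x\in A}\frac{1}{|P_{r(x)}|}\le 1$, and log-concave if the fractions $\frac{|P_{k+1}|}{|P_k|}$, over those $k\ge 0$ with $P_k\neq\emptyset$, are (weakly) decreasing in $k$. **Theorem (Harper, 1974).** Let $P$ and $Q$ be finite posets that are both log-concave and LYM. Then the product poset $P\times Q$, with $(x_P,x_Q)\le(y_P,y_Q)$ if and only if $x_P\le y_P$ and $x_Q\le y_Q$, is also LYM and log-concave. -/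

import Mathlib

namespace RankedPoset

/-- The rank of `x`: the length `n` of a longest chain `x₀ < x₁ < ⋯ < xₙ = x` ending at `x`.
On a finite poset, `rank_eq_zero` and `isGreatest_rank` below show that this is the function with
`rank x = 0` for `x` minimal and `rank x = max {rank y | y < x} + 1` otherwise. -/
noncomputable def rank {P : Type*} [PartialOrder P] (x : P) : ℕ :=
  (Order.height x).toNat

/-- The layer `P_k`: all elements of rank `k`. -/
def layer (P : Type*) [PartialOrder P] (k : ℕ) : Set P :=
  {x | rank x = k}

/-- A poset `P` is LYM if `∑_{x ∈ A} 1 / |P_{r(x)}| ≤ 1` for every antichain `A`. -/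
def IsLYM (P : Type*) [PartialOrder P] : Prop :=
  ∀ A : Finset P, IsAntichain (· ≤ ·) (A : Set P) →
    ∑ x ∈ A, (1 : ℚ) / ((layer P (rank x)).ncard : ℚ) ≤ 1

/-- A poset `P` is log-concave if the fractions `|P_{k+1}| / |P_k|`, over those `k` for which
the denominator is nonzero, are (weakly) decreasing in `k`. -/
def IsLogConcave (P : Type*) [PartialOrder P] : Prop :=
  AntitoneOn (fun k : ℕ => ((layer P (k + 1)).ncard : ℚ) / ((layer P k).ncard : ℚ))
    {k : ℕ | (layer P k).ncard ≠ 0}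

theorem height_eq_rank {P : Type*} [PartialOrder P] [Finite P] (x : P) :
    Order.height x = (rank x : ℕ∞) := by
  have := Fintype.ofFinite P
  have h : Order.height x ≤ (Fintype.card P : ℕ∞) :=
    Order.height_le fun p _ => by exact_mod_cast p.length_lt_card.le
  exact (ENat.natCast_toNat (ne_top_of_le_ne_top (ENat.natCast_ne_top _) h)).symm

theorem rank_eq_zero {P : Type*} [PartialOrder P] {x : P} (h : ∀ y, ¬ y < x) :
    rank x = 0 := by
  have : Order.height x = 0 := Order.height_eq_zero.2 (isMin_iff_forall_not_lt.2 h)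
  simp [rank, this]

theorem isGreatest_rank {P : Type*} [PartialOrder P] [Finite P] {x : P} (h : ∃ y, y < x) :
    IsGreatest {n : ℕ | ∃ y, y < x ∧ n = rank y + 1} (rank x) := by
  have up : ∀ y, y < x → rank y + 1 ≤ rank x := by
    intro y hy
    have := Order.height_add_one_le hy
    rw [height_eq_rank, height_eq_rank] at this
    exact_mod_cast this
  refine ⟨?_, ?_⟩
  · by_contra hne
    have hlt : ∀ y, y < x → rank y + 1 < rank x := fun y hy =>
      lt_of_le_of_ne (up y hy) fun e => hne ⟨y, hy, e.symm⟩
    have hle : Order.height x ≤ ((rank x - 1 : ℕ) : ℕ∞) := by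
      rw [Order.height_le_coe_iff]
      intro y hy
      rw [height_eq_rank]
      have := hlt y hy
      exact_mod_cast (by omega : rank y < rank x - 1)
    rw [height_eq_rank] at hle
    obtain ⟨y, hy⟩ := h
    have h1 := hlt y hy
    have h2 : rank x ≤ rank x - 1 := by exact_mod_cast hle
    omega
  · rintro n ⟨y, hy, rfl⟩
    exact up y hy

end RankedPoset

/-!
Write `p` and `q` for the layer sizes of `P` and `Q`. The layer sizes of `P × Q` are the
convolution of `p` and `q`, so log-concavity is inherited because log-concave sequences are those
whose Toeplitz kernel is totally positive of order two, a property preserved by composition of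
kernels (here a case of the four functions theorem).

For the LYM property, assign to `(x, y)` of rank `k` the subinterval of `[0, 1]` between the
proportions of layer `k` whose first rank is `< r(x)` and `≤ r(x)`. Total positivity of order two
says that these proportions move monotonically with `k`, so that within a product of two chains
the intervals of an antichain do not overlap and their lengths sum to at most `1`. Finally LYM for
`P` is dual to chains: a nonnegative weight `f` with sum at most `1` on every chain satisfies
`∑ f(x) / |P_{r(x)}| ≤ 1`. Applying this in both factors passes from chains to `P × Q`.
-/

open Finset

namespace RankedPoset

section TotalPositivity

variable {α β γ R : Type*} [CommRing R] [LinearOrder R] [IsStrictOrderedRing R]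

/-- A kernel is totally positive of order two if its entries and its `2 × 2` minors are
nonnegative. -/
def IsTP2 [Preorder α] [Preorder β] (K : α → β → R) : Prop :=
  (∀ i j, 0 ≤ K i j) ∧
    ∀ ⦃i i'⦄, i ≤ i' → ∀ ⦃j j'⦄, j ≤ j' → K i j' * K i' j ≤ K i j * K i' j'

theorem IsTP2.sum_mul [Preorder α] [LinearOrder β] [Preorder γ] {K : α → β → R} {L : β → γ → R}
    (hK : IsTP2 K) (hL : IsTP2 L) (s : Finset β) : IsTP2 fun i k => ∑ j ∈ s, K i j * L j k := by
  have nonneg (i k) : 0 ≤ fun j => K i j * L j k := fun j => mul_nonneg (hK.1 i j) (hL.1 j k)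
  refine ⟨fun i k => sum_nonneg fun j _ => nonneg i k j, fun i i' hi k k' hk => ?_⟩
  have lattice_condition (a b : β) : K i a * L a k' * (K i' b * L b k) ≤
      K i (a ⊓ b) * L (a ⊓ b) k * (K i' (a ⊔ b) * L (a ⊔ b) k') := by
    rcases le_total a b with hab | hab
    · rw [inf_eq_left.2 hab, sup_eq_right.2 hab]
      linarith [mul_le_mul_of_nonneg_left (hL.2 hab hk) (mul_nonneg (hK.1 i a) (hK.1 i' b))]
    · rw [inf_eq_right.2 hab, sup_eq_left.2 hab]
      linarith [mul_le_mul_of_nonneg_left (hK.2 hi hab) (mul_nonneg (hL.1 a k') (hL.1 b k))]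
  have inf_closed : InfClosed (s : Set β) := fun a ha b hb => by
    rcases le_total a b with h | h <;> simpa [h]
  have sup_closed : SupClosed (s : Set β) := fun a ha b hb => by
    rcases le_total a b with h | h <;> simpa [h]
  simpa only [infs_self.2 inf_closed, sups_eq_self.2 sup_closed] using
    four_functions_theorem _ _ _ _ (nonneg i k') (nonneg i' k) (nonneg i k) (nonneg i' k')
      lattice_condition s s

theorem isTP2_ite_lt [LinearOrder α] {p : α → R} (hp : ∀ j, 0 ≤ p j) :
    IsTP2 fun j i => if j < i then p j else 0 := by
  refine ⟨fun j i => ?_, fun j j' hj i i' hi => ?_⟩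
  · dsimp only
    split_ifs
    exacts [hp j, le_rfl]
  · by_cases h : j' < i
    · simp [h, h.trans_le hi, hj.trans_lt h, (hj.trans_lt h).trans_le hi]
    · simp only [h, if_false, mul_zero]
      split_ifs <;> simp [mul_nonneg, hp]

end TotalPositivity

section Convolution

variable {R : Type*} [CommSemiring R]

/-- The Toeplitz kernel `p (i - j)`, extended by `0` above the diagonal. -/
def toeplitz (p : ℕ → R) (i j : ℕ) : R :=
  if j ≤ i then p (i - j) else 0

/-- The convolution of two sequences. -/
def convolution (p q : ℕ → R) (k : ℕ) : R :=
  ∑ x ∈ antidiagonal k, p x.1 * q x.2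

/-- The part of the convolution of `p` and `q` at `k` with first index less than `i`. -/
def partialConv (p q : ℕ → R) (i k : ℕ) : R :=
  ∑ x ∈ antidiagonal k with x.1 < i, p x.1 * q x.2

theorem toeplitz_add (p : ℕ → R) (m k : ℕ) : toeplitz p (m + k) k = p m := by
  simp [toeplitz]

theorem sum_range_toeplitz_mul (p f : ℕ → R) {k N : ℕ} (h : k < N) :
    ∑ j ∈ range N, toeplitz p k j * f j = ∑ x ∈ antidiagonal k, p x.1 * f x.2 := by
  rw [← Nat.sum_antidiagonal_swap, Nat.sum_antidiagonal_eq_sum_range_succ_mk,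
    ← sum_subset (range_subset_range.2 (Nat.succ_le_of_lt h))]
  · refine sum_congr rfl fun j hj => ?_
    simp [toeplitz, Nat.lt_succ_iff.1 (mem_range.1 hj)]
  · intro j _ hj
    simp [toeplitz, show ¬ j ≤ k by simpa [Nat.lt_succ_iff] using hj]

theorem sum_range_toeplitz_mul_toeplitz (p q : ℕ → R) {m k N : ℕ} (h : m + k < N) :
    ∑ j ∈ range N, toeplitz p (m + k) j * toeplitz q j k = convolution p q m := by
  rw [sum_range_toeplitz_mul _ _ h, convolution, Nat.sum_antidiagonal_eq_sum_range_succ_mk,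
    Nat.sum_antidiagonal_eq_sum_range_succ_mk,
    ← sum_subset (range_subset_range.2 (by omega : m.succ ≤ (m + k).succ))]
  · refine sum_congr rfl fun a ha => ?_
    have ha : a ≤ m := Nat.lt_succ_iff.1 (mem_range.1 ha)
    rw [show m + k - a = (m - a) + k by omega, toeplitz_add]
  · intro a hak ha
    rw [mem_range] at hak ha
    simp [toeplitz, show ¬ k ≤ m + k - a by omega]

theorem convolution_comm (p q : ℕ → R) (k : ℕ) : convolution p q k = convolution q p k := by
  rw [convolution, convolution, ← Nat.sum_antidiagonal_swap]
  exact sum_congr rfl fun x _ => mul_comm _ _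

theorem partialConv_eq_convolution (p q : ℕ → R) {i k : ℕ} (h : k < i) :
    partialConv p q i k = convolution p q k := by
  rw [partialConv, filter_true_of_mem fun x hx => ?_, convolution]
  exact (HasAntidiagonal.antidiagonal.fst_le hx).trans_lt h

theorem partialConv_eq_sum_range (p q : ℕ → R) {i k N : ℕ} (h : k < N) :
    partialConv p q i k = ∑ j ∈ range N, toeplitz q k j * if j < i then p j else 0 := by
  rw [sum_range_toeplitz_mul q _ h, ← Nat.sum_antidiagonal_swap, partialConv, sum_filter]
  exact sum_congr rfl fun x _ => by simp [mul_comm]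

theorem partialConv_add_one (p q : ℕ → R) (a b : ℕ) :
    partialConv p q (a + 1) (a + b) = p a * q b + partialConv p q a (a + b) := by
  have h : {x ∈ antidiagonal (a + b) | x.1 < a + 1} =
      insert (a, b) {x ∈ antidiagonal (a + b) | x.1 < a} := by
    ext ⟨x, y⟩
    simp only [mem_filter, HasAntidiagonal.mem_antidiagonal, mem_insert, Prod.mk.injEq]
    omega
  rw [partialConv, h, sum_insert (by simp), partialConv]

theorem partialConv_add_partialConv (p q : ℕ → R) (a b : ℕ) :
    partialConv p q a (a + b) + partialConv q p (b + 1) (a + b) = convolution p q (a + b) := by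
  rw [convolution, ← sum_filter_add_sum_filter_not (antidiagonal (a + b)) (·.1 < a), partialConv,
    partialConv]
  congr 1
  simp only [sum_filter]
  rw [← Nat.sum_antidiagonal_swap]
  refine sum_congr rfl fun x hx => ?_
  have : x.2 < b + 1 ↔ ¬ x.1 < a := by
    have := HasAntidiagonal.mem_antidiagonal.1 hx
    omega
  simp [this, mul_comm]

end Convolution

section LogConcave

variable {R : Type*} [CommRing R] [LinearOrder R]

/-- Log-concavity without internal zeros. On nonnegative sequences this is equivalent to
`p (k + 1) / p k` being antitone together with the support being an interval. -/
def IsLogConcaveSeq (p : ℕ → R) : Prop :=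
  (∀ k, 0 ≤ p k) ∧ ∀ ⦃m n⦄, m ≤ n → ∀ d, p m * p (n + d) ≤ p (m + d) * p n

variable [IsStrictOrderedRing R]

theorem IsLogConcaveSeq.isTP2_toeplitz {p : ℕ → R} (hp : IsLogConcaveSeq p) :
    IsTP2 (toeplitz p) := by
  have nonneg (i j) : 0 ≤ toeplitz p i j := by
    unfold toeplitz
    split_ifs
    exacts [hp.1 _, le_rfl]
  refine ⟨nonneg, fun i i' hi j j' hj => ?_⟩
  by_cases h : j' ≤ i
  · have log_concave := hp.2 (show i - j' ≤ i' - j' by omega) (j' - j)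
    rw [show i - j' + (j' - j) = i - j by omega,
      show i' - j' + (j' - j) = i' - j by omega] at log_concave
    simpa only [toeplitz, h, hj.trans h, h.trans hi, hj.trans (h.trans hi), if_true]
      using log_concave
  · rw [toeplitz, if_neg h, zero_mul]
    exact mul_nonneg (nonneg _ _) (nonneg _ _)

theorem isLogConcaveSeq_convolution {p q : ℕ → R} (hp : IsLogConcaveSeq p)
    (hq : IsLogConcaveSeq q) : IsLogConcaveSeq (convolution p q) := by
  refine ⟨fun k => sum_nonneg fun x _ => mul_nonneg (hp.1 _) (hq.1 _), fun m n h d => ?_⟩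
  have minor := (hp.isTP2_toeplitz.sum_mul hq.isTP2_toeplitz (range (n + d + 1))).2
    (Nat.add_le_add_right h d) (Nat.zero_le d)
  have column_d {i : ℕ} (hi : i ≤ n) :=
    sum_range_toeplitz_mul_toeplitz p q (m := i) (k := d) (N := n + d + 1) (by omega)
  have column_zero {i : ℕ} (hi : i ≤ n + d) :
      ∑ j ∈ range (n + d + 1), toeplitz p i j * toeplitz q j 0 = convolution p q i :=
    sum_range_toeplitz_mul_toeplitz p q (k := 0) (by omega)
  simpa only [column_d h, column_d le_rfl, column_zero (Nat.add_le_add_right h d),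
    column_zero le_rfl] using minor

theorem IsLogConcaveSeq.partialConv_mul_convolution_le {p q : ℕ → R} (hp : ∀ k, 0 ≤ p k)
    (hq : IsLogConcaveSeq q) {k l : ℕ} (hkl : k ≤ l) (i : ℕ) :
    partialConv p q i l * convolution p q k ≤ partialConv p q i k * convolution p q l := by
  have minor := (hq.isTP2_toeplitz.sum_mul (isTP2_ite_lt hp) (range (l + 1))).2 hkl
    (le_max_left i (l + 1))
  simp only [← partialConv_eq_sum_range p q (Nat.lt_succ_of_le hkl),
    ← partialConv_eq_sum_range p q (Nat.lt_succ_self l)] at minor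
  rwa [partialConv_eq_convolution p q (i := max i (l + 1)) (by omega),
    partialConv_eq_convolution p q (i := max i (l + 1)) (by omega), mul_comm] at minor

theorem convolution_add_pos {p q : ℕ → R} (hp : ∀ k, 0 ≤ p k) (hq : ∀ k, 0 ≤ q k) {a b : ℕ}
    (ha : 0 < p a) (hb : 0 < q b) : 0 < convolution p q (a + b) :=
  sum_pos' (fun x _ => mul_nonneg (hp x.1) (hq x.2)) ⟨(a, b), by simp, mul_pos ha hb⟩

theorem partialConv_mono {p q : ℕ → R} (hp : ∀ k, 0 ≤ p k) (hq : ∀ k, 0 ≤ q k) (k : ℕ) :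
    Monotone fun i => partialConv p q i k := fun _ _ h =>
  sum_le_sum_of_subset_of_nonneg (monotone_filter_right _ fun _ _ hx => lt_of_lt_of_le hx h)
    fun x _ _ => mul_nonneg (hp x.1) (hq x.2)

end LogConcave

section Fractions

variable {R : Type*} [Field R] {p q : ℕ → R}

/-- The proportion of the convolution of `p` and `q` at `k` with first index less than `i`. -/
def lowerFraction (p q : ℕ → R) (i k : ℕ) : R :=
  partialConv p q i k / convolution p q k

theorem lowerFraction_add_one_sub (p q : ℕ → R) (a b : ℕ) :
    lowerFraction p q (a + 1) (a + b) - lowerFraction p q a (a + b) =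
      p a * q b / convolution p q (a + b) := by
  rw [lowerFraction, lowerFraction, partialConv_add_one, ← sub_div, add_sub_cancel_right]

theorem lowerFraction_add_lowerFraction {a b : ℕ} (h : convolution p q (a + b) ≠ 0) :
    lowerFraction p q a (a + b) + lowerFraction q p (b + 1) (b + a) = 1 := by
  rw [lowerFraction, lowerFraction, convolution_comm q p, add_comm b a, ← add_div,
    partialConv_add_partialConv, div_self h]

variable [LinearOrder R] [IsStrictOrderedRing R]

theorem IsLogConcaveSeq.antitoneOn_div (hp : IsLogConcaveSeq p) :
    AntitoneOn (fun k => p (k + 1) / p k) {k | p k ≠ 0} := by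
  intro k hk l hl hkl
  have pos {j} (hj : p j ≠ 0) : 0 < p j := (hp.1 j).lt_of_ne' hj
  rw [div_le_div_iff₀ (pos hl) (pos hk), mul_comm]
  exact hp.2 hkl 1

theorem isLogConcaveSeq_of_antitoneOn_div (nonneg : ∀ k, 0 ≤ p k)
    (support_lower : ∀ k, p (k + 1) ≠ 0 → p k ≠ 0)
    (anti : AntitoneOn (fun k => p (k + 1) / p k) {k | p k ≠ 0}) : IsLogConcaveSeq p := by
  refine ⟨nonneg, fun m n hmn d => ?_⟩
  induction d with
  | zero => exact le_rfl
  | succ d ih =>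
    by_cases h : p (n + d + 1) = 0
    · rw [← add_assoc, h, mul_zero]
      exact mul_nonneg (nonneg _) (nonneg _)
    have hn := support_lower _ h
    have hm : p (m + d) ≠ 0 := Nat.decreasingInduction
      (motive := fun k _ => p k ≠ 0) (fun k _ => support_lower k) hn
      (Nat.add_le_add_right hmn d)
    calc p m * p (n + d + 1) = p m * p (n + d) * (p (n + d + 1) / p (n + d)) := by field_simp
      _ ≤ p (m + d) * p n * (p (m + d + 1) / p (m + d)) :=
        mul_le_mul ih (anti hm hn (Nat.add_le_add_right hmn d))
          (div_nonneg (nonneg _) (nonneg _)) (mul_nonneg (nonneg _) (nonneg _))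
      _ = p (m + d + 1) * p n := by field_simp

theorem lowerFraction_nonneg (hp : ∀ k, 0 ≤ p k) (hq : ∀ k, 0 ≤ q k) (i k : ℕ) :
    0 ≤ lowerFraction p q i k :=
  div_nonneg (sum_nonneg fun _ _ => mul_nonneg (hp _) (hq _))
    (sum_nonneg fun _ _ => mul_nonneg (hp _) (hq _))

theorem lowerFraction_le_one (hp : ∀ k, 0 ≤ p k) (hq : ∀ k, 0 ≤ q k) (i k : ℕ) :
    lowerFraction p q i k ≤ 1 :=
  div_le_one_of_le₀ (sum_le_sum_of_subset_of_nonneg (filter_subset _ _)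
    fun _ _ _ => mul_nonneg (hp _) (hq _)) (sum_nonneg fun _ _ => mul_nonneg (hp _) (hq _))

theorem IsLogConcaveSeq.lowerFraction_le (hp : ∀ k, 0 ≤ p k) (hq : IsLogConcaveSeq q)
    {i j k l : ℕ} (hij : i ≤ j) (hkl : k ≤ l) (hk : 0 < convolution p q k)
    (hl : 0 < convolution p q l) : lowerFraction p q i l ≤ lowerFraction p q j k := by
  rw [lowerFraction, lowerFraction, div_le_div_iff₀ hl hk]
  exact (hq.partialConv_mul_convolution_le hp hkl i).trans
    (mul_le_mul_of_nonneg_right (partialConv_mono hp hq.1 k hij) hl.le)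

theorem IsLogConcaveSeq.lowerFraction_le_of_cross (hp : IsLogConcaveSeq p)
    (hq : IsLogConcaveSeq q) {a b a' b' : ℕ} (ha : a < a') (hb : b' < b)
    (h : 0 < convolution p q (a + b)) (h' : 0 < convolution p q (a' + b')) :
    lowerFraction p q (a + 1) (a + b) ≤ lowerFraction p q a' (a' + b') := by
  rcases le_total (a' + b') (a + b) with hle | hle
  · exact hq.lowerFraction_le hp.1 ha hle h' h
  · obtain ⟨c, rfl⟩ : ∃ c, b = c + 1 := ⟨b - 1, by omega⟩
    have complement := lowerFraction_add_lowerFraction h'.ne'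
    have complement_succ := lowerFraction_add_lowerFraction (a := a + 1) (b := c)
      (by rw [add_right_comm, add_assoc]; exact h.ne')
    have swapped :
        lowerFraction q p (b' + 1) (a' + b') ≤ lowerFraction q p (c + 1) (a + (c + 1)) :=
      hp.lowerFraction_le hq.1 hb hle (by rwa [convolution_comm]) (by rwa [convolution_comm])
    rw [add_comm b' a'] at complement
    rw [show a + 1 + c = a + (c + 1) by omega, show c + (a + 1) = a + (c + 1) by omega]
      at complement_succ
    linarith

end Fractions

section Antichains

theorem sum_sub_le_of_pairwise_disjoint {ι G : Type*} [AddCommGroup G] [LinearOrder G]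
    [IsOrderedAddMonoid G] {b t : ι → G} {c : G} (hc : 0 ≤ c) (A : Finset ι)
    (nonneg : ∀ i ∈ A, 0 ≤ b i) (lt : ∀ i ∈ A, b i < t i) (le : ∀ i ∈ A, t i ≤ c)
    (disjoint : (A : Set ι).Pairwise fun i j => t i ≤ b j ∨ t j ≤ b i) :
    ∑ i ∈ A, (t i - b i) ≤ c := by
  classical
  induction A using Finset.induction_on_max_value t generalizing c with
  | empty => simpa
  | insert a s ha hmax ih =>
    simp only [mem_insert, forall_eq_or_imp] at nonneg lt le
    have below : ∀ i ∈ s, t i ≤ b a := fun i hi => by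
      refine (disjoint (mem_insert_of_mem hi) (mem_insert_self a s)
        (ne_of_mem_of_not_mem hi ha)).resolve_right fun h => ?_
      exact ((lt.2 i hi).trans_le (hmax i hi)).not_ge h
    have sum_le : ∑ i ∈ s, (t i - b i) ≤ b a :=
      ih nonneg.1 nonneg.2 lt.2 below (disjoint.mono (by simp))
    calc ∑ i ∈ insert a s, (t i - b i) = t a - b a + ∑ i ∈ s, (t i - b i) := sum_insert ha
      _ ≤ t a - b a + b a := by gcongr
      _ = t a := sub_add_cancel _ _
      _ ≤ c := le.1

variable {P Q R : Type*} [PartialOrder P] [PartialOrder Q]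

theorem fst_lt_and_snd_lt_or_of_not_le {z w : P × Q} (h₁ : z.1 ≤ w.1 ∨ w.1 ≤ z.1)
    (h₂ : z.2 ≤ w.2 ∨ w.2 ≤ z.2) (hzw : ¬ z ≤ w) (hwz : ¬ w ≤ z) :
    z.1 < w.1 ∧ w.2 < z.2 ∨ w.1 < z.1 ∧ z.2 < w.2 := by
  rw [Prod.le_def] at hzw hwz
  grind [lt_iff_le_not_ge]

theorem sum_div_convolution_le_one_of_isChain [Field R] [LinearOrder R] [IsStrictOrderedRing R]
    {p q : ℕ → R} (hp : IsLogConcaveSeq p) (hq : IsLogConcaveSeq q) {r : P → ℕ} {s : Q → ℕ}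
    (hr : StrictMono r) (hs : StrictMono s) (hpr : ∀ x, 0 < p (r x)) (hqs : ∀ y, 0 < q (s y))
    {C : Finset P} {D : Finset Q} (hC : IsChain (· ≤ ·) (C : Set P))
    (hD : IsChain (· ≤ ·) (D : Set Q)) {A : Finset (P × Q)} (hACD : A ⊆ C ×ˢ D)
    (hA : IsAntichain (· ≤ ·) (A : Set (P × Q))) :
    ∑ z ∈ A, p (r z.1) * q (s z.2) / convolution p q (r z.1 + s z.2) ≤ 1 := by
  have conv_pos (z : P × Q) : 0 < convolution p q (r z.1 + s z.2) :=
    convolution_add_pos hp.1 hq.1 (hpr z.1) (hqs z.2)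
  simp only [← lowerFraction_add_one_sub]
  refine sum_sub_le_of_pairwise_disjoint zero_le_one A
    (fun z _ => lowerFraction_nonneg hp.1 hq.1 _ _) (fun z _ => ?_)
    (fun z _ => lowerFraction_le_one hp.1 hq.1 _ _) fun z hz w hw hne => ?_
  · rw [← sub_pos, lowerFraction_add_one_sub]
    exact div_pos (mul_pos (hpr _) (hqs _)) (conv_pos z)
  · have hz' := mem_product.1 (hACD hz)
    have hw' := mem_product.1 (hACD hw)
    rcases fst_lt_and_snd_lt_or_of_not_le (hC.total hz'.1 hw'.1) (hD.total hz'.2 hw'.2)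
      (hA hz hw hne) (hA hw hz hne.symm) with h | h
    · exact .inl (hp.lowerFraction_le_of_cross hq (hr h.1) (hs h.2) (conv_pos z) (conv_pos w))
    · exact .inr (hp.lowerFraction_le_of_cross hq (hr h.1) (hs h.2) (conv_pos w) (conv_pos z))

theorem exists_minimal_isChain_insert {S C : Finset P} (hS : S.Nonempty) (hCS : C ⊆ S)
    (hC : IsChain (· ≤ ·) (C : Set P)) :
    ∃ a, Minimal (· ∈ S) a ∧ IsChain (· ≤ ·) (insert a (C : Set P)) := by
  rcases C.eq_empty_or_nonempty with rfl | hne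
  · obtain ⟨a, ha⟩ := S.exists_minimal hS
    exact ⟨a, ha, by simp⟩
  · obtain ⟨c, hc⟩ := C.exists_minimal hne
    obtain ⟨a, hac, ha⟩ := S.exists_le_minimal (hCS hc.prop)
    refine ⟨a, ha, hC.insert fun x hx _ => .inl (hac.trans ?_)⟩
    exact (hC.total hc.prop hx).elim id fun h => hc.le_of_le hx h

variable [CommRing R] [LinearOrder R]

/-- A weight on a poset with sum at most `1` on each antichain. The poset `P` is LYM if and only if
`fun x => 1 / |P_{r(x)}|` is such a weight. -/
def IsLYMWeight (w : P → R) : Prop :=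
  ∀ A : Finset P, IsAntichain (· ≤ ·) (A : Set P) → ∑ x ∈ A, w x ≤ 1

variable [IsStrictOrderedRing R]

open Classical in
theorem sum_sub_ite_minimal_le_of_isChain {f : P → R} {m M : R} {S C : Finset P}
    (hS : S.Nonempty) (hm : 0 ≤ m) (hf : ∀ x ∈ S, 0 ≤ f x)
    (m_le : ∀ x, Minimal (· ∈ S) x → m ≤ f x)
    (hM : ∀ C ⊆ S, IsChain (· ≤ ·) (C : Set P) → ∑ x ∈ C, f x ≤ M) (hCS : C ⊆ S)
    (hC : IsChain (· ≤ ·) (C : Set P)) :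
    ∑ x ∈ C, (f x - if Minimal (· ∈ S) x then m else 0) ≤ M - m := by
  obtain ⟨a, ha, haC⟩ := exists_minimal_isChain_insert hS hCS hC
  have haCS : insert a C ⊆ S := insert_subset ha.prop hCS
  calc ∑ x ∈ C, (f x - if Minimal (· ∈ S) x then m else 0)
      ≤ ∑ x ∈ insert a C, (f x - if Minimal (· ∈ S) x then m else 0) := by
        refine sum_le_sum_of_subset_of_nonneg (subset_insert a C) fun x hx _ => ?_
        split_ifs with hmin
        exacts [sub_nonneg.2 (m_le x hmin), by simpa using hf x (haCS hx)]
    _ = ∑ x ∈ insert a C, f x - ∑ x ∈ insert a C, if Minimal (· ∈ S) x then m else 0 :=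
        sum_sub_distrib _ _
    _ ≤ M - m := by
        refine sub_le_sub (hM _ haCS (by simpa using haC)) ?_
        simpa only [ha, if_true] using
          single_le_sum (f := fun x => if Minimal (· ∈ S) x then m else 0)
            (fun x _ => ite_nonneg hm le_rfl) (mem_insert_self a C)

theorem IsLYMWeight.sum_mul_le {w : P → R} (hw : IsLYMWeight w) {f : P → R} {M : R}
    (S : Finset P) (hf : ∀ x ∈ S, 0 ≤ f x)
    (hM : ∀ C ⊆ S, IsChain (· ≤ ·) (C : Set P) → ∑ x ∈ C, f x ≤ M) : ∑ x ∈ S, f x * w x ≤ M := by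
  classical
  induction S using Finset.strongInduction generalizing f M with
  | H S ih =>
  rcases S.eq_empty_or_nonempty with rfl | hS
  · simpa using hM ∅
  let A := {x ∈ S | Minimal (· ∈ S) x}
  have hA : IsAntichain (· ≤ ·) (A : Set P) :=
    (setOfPred_minimal_antichain (· ∈ S)).subset fun x hx => (mem_filter.1 hx).2
  obtain ⟨a, ha, a_min⟩ := A.exists_min_image f
    (let ⟨x, hx⟩ := S.exists_minimal hS; ⟨x, mem_filter.2 ⟨hx.prop, hx⟩⟩)
  obtain ⟨haS, ha⟩ := mem_filter.1 ha
  have fa_le (x) (hx : Minimal (· ∈ S) x) : f a ≤ f x := a_min x (mem_filter.2 ⟨hx.prop, hx⟩)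
  let g x := f x - if Minimal (· ∈ S) x then f a else 0
  have ga : g a = 0 := by simp [g, ha]
  have g_nonneg : ∀ x ∈ S, 0 ≤ g x := fun x hx => by
    by_cases hmin : Minimal (· ∈ S) x
    · simpa [g, hmin] using fa_le x hmin
    · simpa [g, hmin] using hf x hx
  have sum_g_le : ∑ x ∈ S.erase a, g x * w x ≤ M - f a :=
    ih _ (erase_ssubset haS) (fun x hx => g_nonneg x (mem_of_mem_erase hx)) fun C hCS hC =>
      sum_sub_ite_minimal_le_of_isChain hS (hf a haS) hf fa_le hM (hCS.trans (erase_subset a S)) hC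
  calc ∑ x ∈ S, f x * w x
      = ∑ x ∈ S.erase a, g x * w x + f a * ∑ x ∈ A, w x := by
        rw [sum_erase _ (by rw [ga, zero_mul]), mul_sum, sum_filter, ← sum_add_distrib]
        refine sum_congr rfl fun x _ => ?_
        simp only [g]
        split_ifs <;> ring
    _ ≤ (M - f a) + f a * 1 :=
        add_le_add sum_g_le (mul_le_mul_of_nonneg_left (hw A hA) (hf a haS))
    _ = M := by ring

theorem IsLYMWeight.sum_product_mul_le {u : P → R} {v : Q → R} (hu : IsLYMWeight u)
    (hv : IsLYMWeight v) (v_nonneg : ∀ y, 0 ≤ v y) {S : Finset P} {T : Finset Q}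
    {f : P × Q → R} (hf : ∀ z, 0 ≤ f z) {M : R}
    (hM : ∀ C ⊆ S, ∀ D ⊆ T, IsChain (· ≤ ·) (C : Set P) → IsChain (· ≤ ·) (D : Set Q) →
      ∑ z ∈ C ×ˢ D, f z ≤ M) :
    ∑ z ∈ S ×ˢ T, f z * v z.2 * u z.1 ≤ M := by
  simp only [sum_product, ← sum_mul]
  refine hu.sum_mul_le S (fun x _ => sum_nonneg fun y _ => mul_nonneg (hf _) (v_nonneg y))
    fun C hCS hC => ?_
  rw [sum_comm]
  simp only [← sum_mul]
  refine hv.sum_mul_le T (fun y _ => sum_nonneg fun x _ => hf _) fun D hDT hD => ?_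
  rw [← sum_product_right]
  exact hM C hCS D hDT hC hD

end Antichains

theorem IsLYMWeight.prod {P Q R : Type*} [PartialOrder P] [PartialOrder Q] [Field R]
    [LinearOrder R] [IsStrictOrderedRing R] {p q : ℕ → R} {r : P → ℕ} {s : Q → ℕ}
    (hp : IsLogConcaveSeq p) (hq : IsLogConcaveSeq q) (hr : StrictMono r) (hs : StrictMono s)
    (hpr : ∀ x, 0 < p (r x)) (hqs : ∀ y, 0 < q (s y))
    (hP : IsLYMWeight fun x => 1 / p (r x)) (hQ : IsLYMWeight fun y => 1 / q (s y)) :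
    IsLYMWeight fun z : P × Q => 1 / convolution p q (r z.1 + s z.2) := by
  classical
  intro A hA
  let f (z : P × Q) : R := p (r z.1) * q (s z.2) / convolution p q (r z.1 + s z.2)
  have f_nonneg (z) : 0 ≤ f z := div_nonneg (mul_nonneg (hpr _).le (hqs _).le)
    (convolution_add_pos hp.1 hq.1 (hpr _) (hqs _)).le
  have bound := hP.sum_product_mul_le hQ (fun y => (one_div_pos.2 (hqs y)).le)
    (S := A.image Prod.fst) (T := A.image Prod.snd) (f := fun z => if z ∈ A then f z else 0)
    (M := 1) (fun z => ite_nonneg (f_nonneg z) le_rfl) fun C _ D _ hC hD => by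
      rw [← sum_filter]
      exact sum_div_convolution_le_one_of_isChain hp hq hr hs hpr hqs hC hD (filter_subset _ _)
        (hA.subset fun z hz => (mem_filter.1 hz).2)
  refine le_of_eq_of_le ?_ bound
  rw [← sum_subset subset_product fun z _ hz => by simp [hz]]
  refine sum_congr rfl fun z hz => ?_
  have := (hpr z.1).ne'
  have := (hqs z.2).ne'
  simp only [hz, if_true, f]
  field_simp

section Rank

variable {P Q : Type*} [PartialOrder P] [PartialOrder Q]

theorem height_prodMk_le_of_le (k : ℕ) (x : P) (y : Q) (h : Order.height x + Order.height y ≤ k) :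
    Order.height (x, y) ≤ k := by
  induction k generalizing x y with
  | zero =>
    have hx : IsMin x := by simpa using (le_self_add.trans h)
    have hy : IsMin y := by simpa using (le_add_self.trans h)
    simpa using hx.prodMk hy
  | succ k ih =>
    rw [Order.height_le_coe_iff]
    rintro ⟨x', y'⟩ hlt
    have : Order.height x' + Order.height y' + 1 ≤ Order.height x + Order.height y := by
      rcases Prod.mk_lt_mk.1 hlt with ⟨hx, hy⟩ | ⟨hx, hy⟩
      · rw [add_right_comm]
        exact add_le_add (Order.height_add_one_le hx) (Order.height_mono hy)
      · rw [add_assoc]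
        exact add_le_add (Order.height_mono hx) (Order.height_add_one_le hy)
    have := ih x' y' ((ENat.add_le_add_iff_right ENat.one_ne_top).1 (by simpa using this.trans h))
    exact this.trans_lt (by exact_mod_cast k.lt_succ_self)

theorem height_add_le_height_prodMk (n : ℕ) (x : P) (y : Q) (h : n ≤ Order.height y) :
    Order.height x + n ≤ Order.height (x, y) := by
  induction n generalizing y with
  | zero =>
    simpa using Order.height_le_height_apply_of_strictMono (·, y)
      (fun _ _ hx => Prod.mk_lt_mk_iff_left.2 hx) x
  | succ n ih =>
    obtain ⟨y', hy, hn⟩ : ∃ y' < y, n ≤ Order.height y' := by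
      by_contra! hlt
      exact (Order.height_le_coe_iff.2 hlt).not_gt
        (lt_of_lt_of_le (by exact_mod_cast n.lt_succ_self) h)
    calc Order.height x + (n + 1 : ℕ) = Order.height x + n + 1 := by push_cast; rw [add_assoc]
      _ ≤ Order.height (x, y') + 1 := by gcongr; exact ih y' hn
      _ ≤ Order.height (x, y) := Order.height_add_one_le (Prod.mk_lt_mk_iff_right.2 hy)

theorem height_prodMk (x : P) (y : Q) : Order.height (x, y) = Order.height x + Order.height y := by
  refine le_antisymm ?_ ?_
  · cases h : Order.height x + Order.height y with
    | top => exact le_top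
    | coe k => exact height_prodMk_le_of_le k x y h.le
  · cases h : Order.height y with
    | top =>
      rw [add_top, top_le_iff, ← top_le_iff, ← h]
      exact Order.height_le_height_apply_of_strictMono (x, ·)
        (fun _ _ hy => Prod.mk_lt_mk_iff_right.2 hy) y
    | coe n => exact height_add_le_height_prodMk n x y h.ge

/-- The poset has finite layers and each of its elements has finite rank. The second condition
excludes the junk value `rank x = 0` at elements `x` of infinite height. -/
structure HasFiniteLayers (P : Type*) [PartialOrder P] : Prop where
  layer_finite : ∀ k, (layer P k).Finite
  height_ne_top : ∀ x : P, Order.height x ≠ ⊤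

theorem hasFiniteLayers_of_finite [Finite P] : HasFiniteLayers P where
  layer_finite _ := Set.toFinite _
  height_ne_top x := by rw [height_eq_rank]; exact ENat.natCast_ne_top _

namespace HasFiniteLayers

theorem coe_rank (hP : HasFiniteLayers P) (x : P) : (rank x : ℕ∞) = Order.height x :=
  ENat.natCast_toNat (hP.height_ne_top x)

theorem rank_strictMono (hP : HasFiniteLayers P) : StrictMono (rank : P → ℕ) := fun x y h => by
  rw [← ENat.natCast_lt_natCast, hP.coe_rank, hP.coe_rank]
  exact Order.height_strictMono h (hP.height_ne_top x).lt_top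

theorem rank_prodMk (hP : HasFiniteLayers P) (hQ : HasFiniteLayers Q) (x : P) (y : Q) :
    rank (x, y) = rank x + rank y := by
  rw [rank, height_prodMk, ENat.toNat_add (hP.height_ne_top x) (hQ.height_ne_top y), rank, rank]

theorem layer_prod (hP : HasFiniteLayers P) (hQ : HasFiniteLayers Q) (k : ℕ) :
    layer (P × Q) k = ⋃ ij ∈ (antidiagonal k : Set (ℕ × ℕ)), layer P ij.1 ×ˢ layer Q ij.2 := by
  ext ⟨x, y⟩
  simp [layer, hP.rank_prodMk hQ]

theorem prod (hP : HasFiniteLayers P) (hQ : HasFiniteLayers Q) : HasFiniteLayers (P × Q) where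
  layer_finite k := by
    rw [hP.layer_prod hQ]
    exact (finite_toSet _).biUnion fun ij _ => (hP.layer_finite _).prod (hQ.layer_finite _)
  height_ne_top := fun (x, y) => by
    rw [height_prodMk]
    exact WithTop.add_ne_top.2 ⟨hP.height_ne_top x, hQ.height_ne_top y⟩

end HasFiniteLayers

/-- The size of the layer `P_k`, as a rational number. -/
noncomputable def layerSize (P : Type*) [PartialOrder P] (k : ℕ) : ℚ :=
  (layer P k).ncard

namespace HasFiniteLayers

theorem layerSize_rank_pos (hP : HasFiniteLayers P) (x : P) : 0 < layerSize P (rank x) := by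
  have : (layer P (rank x)).Nonempty := ⟨x, rfl⟩
  exact Nat.cast_pos.2 (this.ncard_pos (hP.layer_finite _))

theorem layerSize_ne_zero_of_succ (hP : HasFiniteLayers P) {k : ℕ}
    (h : layerSize P (k + 1) ≠ 0) : layerSize P k ≠ 0 := by
  obtain ⟨x, hx⟩ : (layer P (k + 1)).Nonempty :=
    Set.nonempty_of_ncard_ne_zero (by simpa [layerSize] using h)
  have rank_lt : (k : ℕ∞) < Order.height x := by
    rw [← hP.coe_rank x, show rank x = k + 1 from hx]
    exact_mod_cast k.lt_succ_self
  obtain ⟨y, -, hy⟩ := (Order.coe_lt_height_iff (hP.height_ne_top x).lt_top).1 rank_lt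
  have : rank y = k := by rw [rank, hy, ENat.toNat_natCast]
  exact this ▸ (hP.layerSize_rank_pos y).ne'

theorem isLogConcave_iff (hP : HasFiniteLayers P) :
    IsLogConcave P ↔ IsLogConcaveSeq (layerSize P) := by
  have support : {k | layerSize P k ≠ 0} = {k | (layer P k).ncard ≠ 0} := by simp [layerSize]
  refine ⟨fun h => ?_, fun h => ?_⟩
  · exact isLogConcaveSeq_of_antitoneOn_div (fun _ => Nat.cast_nonneg _)
      (fun _ => hP.layerSize_ne_zero_of_succ) (support ▸ h)
  · rw [IsLogConcave, ← support]
    exact h.antitoneOn_div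

theorem layerSize_prod (hP : HasFiniteLayers P) (hQ : HasFiniteLayers Q) :
    layerSize (P × Q) = convolution (layerSize P) (layerSize Q) := by
  ext k
  have disjoint : (antidiagonal k : Set (ℕ × ℕ)).PairwiseDisjoint
      fun ij => layer P ij.1 ×ˢ layer Q ij.2 := fun ij _ ij' _ hne =>
    Set.disjoint_left.2 fun z hz hz' =>
      hne (Prod.ext (hz.1.symm.trans hz'.1) (hz.2.symm.trans hz'.2))
  rw [layerSize, hP.layer_prod hQ, (finite_toSet _).ncard_biUnion
    (fun ij _ => (hP.layer_finite _).prod (hQ.layer_finite _)) disjoint, finsum_mem_coe_finset]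
  simp [convolution, layerSize, Set.ncard_prod]

end HasFiniteLayers

end Rank

end RankedPoset

open RankedPoset in
theorem theorem2p1_general {P Q : Type*} [PartialOrder P] [PartialOrder Q]
    (hP : HasFiniteLayers P) (hQ : HasFiniteLayers Q) (lymP : IsLYM P) (lcP : IsLogConcave P)
    (lymQ : IsLYM Q) (lcQ : IsLogConcave Q) : IsLYM (P × Q) ∧ IsLogConcave (P × Q) := by
  rw [hP.isLogConcave_iff] at lcP
  rw [hQ.isLogConcave_iff] at lcQ
  have lym : IsLYMWeight fun z : P × Q => 1 / layerSize (P × Q) (rank z) := by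
    simpa only [← hP.layerSize_prod hQ, ← hP.rank_prodMk hQ] using
      IsLYMWeight.prod lcP lcQ hP.rank_strictMono hQ.rank_strictMono
        hP.layerSize_rank_pos hQ.layerSize_rank_pos lymP lymQ
  refine ⟨lym, ?_⟩
  rw [(hP.prod hQ).isLogConcave_iff, hP.layerSize_prod hQ]
  exact isLogConcaveSeq_convolution lcP lcQ

theorem theorem2p1 {P : Type*} {Q : Type*} [PartialOrder P] [Finite P]
    [PartialOrder Q] [Finite Q]
    (hP : RankedPoset.IsLYM P) (hP' : RankedPoset.IsLogConcave P)
    (hQ : RankedPoset.IsLYM Q) (hQ' : RankedPoset.IsLogConcave Q) :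
    RankedPoset.IsLYM (P × Q) ∧ RankedPoset.IsLogConcave (P × Q) :=
  theorem2p1_general RankedPoset.hasFiniteLayers_of_finite RankedPoset.hasFiniteLayers_of_finite
    hP hP' hQ hQ'
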